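/- Let $\Sigma$ be a finite alphabet. The formulas $\varphi$ and terms $t$ of $\mathsf{LTL}[\mathsf{Count}]$ are given by $$\varphi ::= a \mid t\le t \mid \neg\varphi \mid \varphi\lor\varphi \mid \mathrm{X}\,\varphi \mid \varphi\,\mathrm{U}\,\varphi,\qquad t ::= k \mid k\cdot\overleftarrow{\#\varphi} \mid k\cdot\overrightarrow{\#\varphi} \mid t+t \qquad (a\in\Sigma,\ k\in\mathbb{Z}).$$ For a word $w=a_1\cdots a_\ell\in\Sigma^*$ and a position $1\le i\le \ell$, satisfaction $w,i\models\varphi$ is defined as follows: $w,i\models a$ iff $a_i=a$; the connectives $\neg,\lor$ are Boolean; $w,i\models \mathrm{X}\varphi$ iff $i<\ell$ and $w,i+1\models\varphi$; $w,i\models\varphi\,\mathrm{U}\,\psi$ iff there is $j$ with $i\le j\le\ell$, $w,j\models\psi$ and $w,k\models\varphi$ for all $i\le k<j$; and $w,i\models t_1\le t_2$ iff $[\![t_1]\!](w,i)\le[\![t_2]\!](w,i)$, where $[\![k]\!](w,i)=k$, $[\![t_1+t_2]\!](w,i)=[\![t_1]\!](w,i)+[\![t_2]\!](w,i)$, $[\![k\cdot\overleftarrow{\#\varphi}]\!](w,i)=k\cdot|\{1\le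 j<i : w,j\models\varphi\}|$ and $[\![k\cdot\overrightarrow{\#\varphi}]\!](w,i)=k\cdot|\{i\le j\le\ell : w,j\models\varphi\}|$. A language $L\subseteq\Sigma^*$ is definable in $\mathsf{LTL}[\mathsf{Count}]$ if there is a formula $\varphi$ such that, for every nonempty word $w\in\Sigma^*$, $w\in L$ iff $w,1\models\varphi$ (whether the empty word belongs to $L$ is immaterial). The Parikh map $\Psi\colon\Sigma^*\to\mathbb{N}^\Sigma$ sends $w$ to the vector of the numbers of occurrences $|w|_a$ of the letters $a\in\Sigma$. The language $L$ is permutation-invariant if, for all $u,v\in\Sigma^*$ with $\Psi(u)=\Psi(v)$, $u\in L$ iff $v\in L$. A subset of $\mathbb{N}^\Sigma$ is semilinear if it is a finite union of sets of the form $\{b+n_1p_1+\dots+n_rp_r : n_1,\dots,n_r\in\mathbb{N}\}$ with $b,p_1,\dots,p_r\in\mathbb{N}^\Sigma$. **Theorem.** If $L\subseteq\Sigma^*$ is permutation-invariant and definable in $\mathsf{LTL}[\mathsf{Count}]$, then its Parikh image $\Psi(L)=\{\Psi(w) : w\in L\}$ is semilinear. -/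

import Mathlib

namespace LTLCount

universe u

mutual

/-- Formulas of `LTL[Count]` over the alphabet `α`:
`φ ::= a | t ≤ t | ¬ φ | φ ∨ φ | X φ | φ U φ`. -/
inductive Formula (α : Type u)
  | letter (a : α) : Formula α
  | le (s t : Term α) : Formula α
  | neg (φ : Formula α) : Formula α
  | or (φ ψ : Formula α) : Formula α
  | next (φ : Formula α) : Formula α
  | untl (φ ψ : Formula α) : Formula α

/-- Counting terms of `LTL[Count]`, with integer coefficients:
`t ::= k | k · #←φ | k · #→φ | t + t`. -/
inductive Term (α : Type u)
  | const (k : ℤ) : Term α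
  | countLeft (k : ℤ) (φ : Formula α) : Term α
  | countRight (k : ℤ) (φ : Formula α) : Term α
  | add (s t : Term α) : Term α

end

mutual

/-- `Sat w φ i` says that the word `w` satisfies `φ` at position `i`. Positions are numbered from
`0`, so the positions of `w` are the `i < w.length`; the first position is `0`. -/
noncomputable def Sat {α : Type u} (w : List α) : Formula α → ℕ → Prop
  | .letter a, i => w[i]? = some a
  | .le s t, i => termVal w s i ≤ termVal w t i
  | .neg φ, i => ¬ Sat w φ i
  | .or φ ψ, i => Sat w φ i ∨ Sat w ψ i
  | .next φ, i => i + 1 < w.length ∧ Sat w φ (i + 1)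
  | .untl φ ψ, i =>
      ∃ j, i ≤ j ∧ j < w.length ∧ Sat w ψ j ∧ ∀ k, i ≤ k → k < j → Sat w φ k

/-- The value of a term in the word `w` at position `i`. The left count ranges over the positions
strictly before `i`, the right count over the positions from `i` on, `i` included. -/
noncomputable def termVal {α : Type u} (w : List α) : Term α → ℕ → ℤ
  | .const k, _ => k
  | .countLeft k φ, i => k * ({j : ℕ | j < i ∧ Sat w φ j}.ncard : ℤ)
  | .countRight k φ, i => k * ({j : ℕ | i ≤ j ∧ j < w.length ∧ Sat w φ j}.ncard : ℤ)
  | .add s t, i => termVal w s i + termVal w t i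

end

/-- A language is definable in `LTL[Count]` if some formula holds at the first position of exactly
those nonempty words that belong to the language. The empty word has no position, hence formulas
do not speak about it; a definable language may contain it or not. -/
def Definable {α : Type u} (L : Language α) : Prop :=
  ∃ φ : Formula α, ∀ w : List α, w ≠ [] → (w ∈ L ↔ Sat w φ 0)

/-- The Parikh map: the vector of the numbers of occurrences of each letter. -/
def parikh {α : Type u} [DecidableEq α] (w : List α) : α → ℕ := fun a => w.count a

/-- Membership in the language depends only on the Parikh vector. -/
def PermutationInvariant {α : Type u} [DecidableEq α] (L : Language α) : Prop :=
  ∀ u v : List α, parikh u = parikh v → (u ∈ L ↔ v ∈ L)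

/-- The Parikh image of a language. -/
def parikhImage {α : Type u} [DecidableEq α] (L : Language α) : Set (α → ℕ) :=
  {x | ∃ w ∈ L, parikh w = x}

end LTLCount

/-!
By permutation invariance, a vector `n` lies in the Parikh image of `L` iff `L` contains the word
that lists its letters in blocks of lengths `n a`. The letters and positions of this word are
semilinear in `n`, so it suffices that the semantics of `LTL[Count]` stays within semilinear
predicates. These are closed under Boolean operations and quantifiers over `ℕ`; the one substantial
step is counting: if a semilinear `s ⊆ M × ℕ` has finite sections, then the cardinality of the
section over `x` is a semilinear function of `x`.

A proper linear set (one with independent periods) is convex along a suitable progression in the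
last coordinate: it contains all points `(x, y + j * D)` lying between two of its points. Each
residue class modulo `D` of a section is therefore an interval, and the semilinear condition that
it equals `[a, a + n)` for some `a` defines its length `n`. A semilinear set is a finite union of
proper linear sets, with a common `D`, and convexity survives intersections, so inclusion–exclusion
yields the general count.
-/

namespace LTLCount

section Semilinear

variable {M N P : Type*} [AddCommMonoid M] [AddCommMonoid N] [AddCommMonoid P]

/-- A predicate on a commutative monoid whose truth set is semilinear. -/
def SemilinearPred (p : M → Prop) : Prop :=
  IsSemilinearSet {x | p x}

/-- A function between commutative monoids whose graph is semilinear. It need not be additive: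
Mathlib's additive "semilinear maps" are unrelated. -/
@[fun_prop]
def SemilinearFun (f : M → N) : Prop :=
  SemilinearPred fun z : M × N => f z.1 = z.2

theorem SemilinearPred.congr {p q : M → Prop} (hp : SemilinearPred p) (h : ∀ x, q x ↔ p x) :
    SemilinearPred q := by
  rwa [show q = p from funext fun x => propext (h x)]

theorem SemilinearPred.and {p q : M → Prop} (hp : SemilinearPred p) (hq : SemilinearPred q) :
    SemilinearPred fun x => p x ∧ q x :=
  IsSemilinearSet.inter hp hq

theorem SemilinearPred.or {p q : M → Prop} (hp : SemilinearPred p) (hq : SemilinearPred q) :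
    SemilinearPred fun x => p x ∨ q x :=
  IsSemilinearSet.union hp hq

theorem SemilinearPred.exists {p : M → N → Prop}
    (hp : SemilinearPred fun z : M × N => p z.1 z.2) : SemilinearPred fun x => ∃ y, p x y := by
  have hfst : SemilinearPred (· ∈ AddMonoidHom.fst M N '' {z | p z.1 z.2}) :=
    IsSemilinearSet.image hp _
  exact hfst.congr fun x => by simp

variable [AddMonoid.FG M]

theorem SemilinearPred.not {p : M → Prop} (hp : SemilinearPred p) : SemilinearPred fun x => ¬ p x :=
  IsSemilinearSet.compl hp

theorem SemilinearPred.imp {p q : M → Prop} (hp : SemilinearPred p) (hq : SemilinearPred q) :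
    SemilinearPred fun x => p x → q x :=
  (hp.not.or hq).congr fun _ => imp_iff_not_or

theorem SemilinearPred.iff {p q : M → Prop} (hp : SemilinearPred p) (hq : SemilinearPred q) :
    SemilinearPred fun x => p x ↔ q x :=
  ((hp.imp hq).and (hq.imp hp)).congr fun _ => iff_iff_implies_and_implies

theorem SemilinearPred.const (p : Prop) : SemilinearPred fun _ : M => p := by
  by_cases hp : p
  · simp [SemilinearPred, hp]
  · simp [SemilinearPred, hp]

theorem SemilinearPred.comp_hom {p : N → Prop} (hp : SemilinearPred p) (g : M →+ N) :
    SemilinearPred fun x => p (g x) :=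
  IsSemilinearSet.preimage hp g

variable [AddMonoid.FG N] [AddMonoid.FG P]

theorem SemilinearPred.forall {p : M → N → Prop}
    (hp : SemilinearPred fun z : M × N => p z.1 z.2) : SemilinearPred fun x => ∀ y, p x y :=
  (SemilinearPred.exists (p := fun x y => ¬ p x y) hp.not).not.congr fun _ => not_exists_not.symm

theorem SemilinearFun.of_hom (g : M →+ N) : SemilinearFun g := by
  have h := isSemilinearSet_setOfPred_eq 0 0 (g.comp (AddMonoidHom.fst M N)) (AddMonoidHom.snd M N)
  simpa [SemilinearFun, SemilinearPred] using h

@[fun_prop]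
theorem SemilinearFun.id : SemilinearFun fun x : M => x :=
  .of_hom (AddMonoidHom.id M)

@[fun_prop]
theorem SemilinearFun.const (c : N) : SemilinearFun fun _ : M => c := by
  have h := isSemilinearSet_setOfPred_eq c 0 (0 : M × N →+ N) (AddMonoidHom.snd M N)
  simpa [SemilinearFun, SemilinearPred] using h

@[fun_prop]
theorem SemilinearFun.comp {g : N → P} {f : M → N} (hg : SemilinearFun g) (hf : SemilinearFun f) :
    SemilinearFun fun x => g (f x) := by
  have hfg : SemilinearPred fun z : (M × P) × N => f z.1.1 = z.2 ∧ g z.2 = z.1.2 :=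
    (SemilinearPred.comp_hom hf
        (((AddMonoidHom.fst M P).comp (.fst _ N)).prod (.snd _ N))).and
      (SemilinearPred.comp_hom hg
        ((AddMonoidHom.snd _ N).prod ((AddMonoidHom.snd M P).comp (.fst _ N))))
  exact (SemilinearPred.exists (p := fun z y => f z.1 = y ∧ g y = z.2) hfg).congr fun _ => by simp

@[fun_prop]
theorem SemilinearFun.prodMk {f : M → N} {g : M → P} (hf : SemilinearFun f)
    (hg : SemilinearFun g) : SemilinearFun fun x => (f x, g x) :=
  ((SemilinearPred.comp_hom hf ((AddMonoidHom.id M).prodMap (.fst N P))).and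
    (SemilinearPred.comp_hom hg ((AddMonoidHom.id M).prodMap (.snd N P)))).congr fun _ =>
      Prod.ext_iff

@[fun_prop]
theorem SemilinearFun.fst : SemilinearFun fun z : M × N => z.1 :=
  .of_hom (AddMonoidHom.fst M N)

@[fun_prop]
theorem SemilinearFun.snd : SemilinearFun fun z : M × N => z.2 :=
  .of_hom (AddMonoidHom.snd M N)

@[fun_prop]
theorem SemilinearFun.add {f g : M → N} (hf : SemilinearFun f) (hg : SemilinearFun g) :
    SemilinearFun fun x => f x + g x :=
  (SemilinearFun.of_hom (AddMonoidHom.coprod (.id N) (.id N))).comp (hf.prodMk hg)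

@[fun_prop]
theorem SemilinearFun.const_mul {R : Type*} [NonUnitalNonAssocSemiring R] [AddMonoid.FG R] (r : R)
    {f : M → R} (hf : SemilinearFun f) : SemilinearFun fun x => r * f x :=
  (SemilinearFun.of_hom (AddMonoidHom.mulLeft r)).comp hf

@[fun_prop]
theorem SemilinearFun.natCast {R : Type*} [NonAssocSemiring R] [AddMonoid.FG R] {f : M → ℕ}
    (hf : SemilinearFun f) : SemilinearFun fun x => (f x : R) :=
  (SemilinearFun.of_hom (Nat.castAddMonoidHom R)).comp hf

theorem SemilinearFun.sum {ι : Type*} (s : Finset ι) {f : ι → M → N}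
    (hf : ∀ i ∈ s, SemilinearFun (f i)) : SemilinearFun fun x => ∑ i ∈ s, f i x := by
  induction s using Finset.cons_induction with
  | empty => simpa using SemilinearFun.const 0
  | cons i s hi ih =>
    simp only [Finset.sum_cons]
    exact (hf i (by simp)).add (ih fun j hj => hf j (by simp [hj]))

theorem SemilinearPred.comp {p : N → Prop} {f : M → N} (hp : SemilinearPred p)
    (hf : SemilinearFun f) : SemilinearPred fun x => p (f x) :=
  (SemilinearPred.exists (p := fun x y => f x = y ∧ p y)
    (hf.and (hp.comp_hom (.snd M N)))).congr fun _ => by simp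

theorem SemilinearPred.eq {f g : M → N} (hf : SemilinearFun f) (hg : SemilinearFun g) :
    SemilinearPred fun x => f x = g x :=
  SemilinearPred.comp hf (SemilinearFun.id.prodMk hg)

theorem SemilinearFun.of_add_eq [IsRightCancelAdd N] {f g h : M → N} (hg : SemilinearFun g)
    (hh : SemilinearFun h) (hadd : ∀ x, f x + g x = h x) : SemilinearFun f := by
  have hgraph : SemilinearPred fun z : M × N => z.2 + g z.1 = h z.1 :=
    .eq (by fun_prop) (by fun_prop)
  exact hgraph.congr fun z => by rw [← hadd, add_left_inj, eq_comm]

theorem SemilinearPred.int_le {f g : M → ℤ} (hf : SemilinearFun f) (hg : SemilinearFun g) :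
    SemilinearPred fun x => f x ≤ g x :=
  (SemilinearPred.exists (p := fun x (n : ℕ) => f x + n = g x)
    (.eq (by fun_prop) (by fun_prop))).congr fun _ =>
      ⟨Int.le.dest, fun ⟨_, h⟩ => Int.le.intro _ h⟩

theorem SemilinearPred.nat_le {f g : M → ℕ} (hf : SemilinearFun f) (hg : SemilinearFun g) :
    SemilinearPred fun x => f x ≤ g x :=
  (SemilinearPred.int_le hf.natCast hg.natCast).congr fun _ => Int.ofNat_le.symm

theorem SemilinearPred.nat_lt {f g : M → ℕ} (hf : SemilinearFun f) (hg : SemilinearFun g) :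
    SemilinearPred fun x => f x < g x :=
  SemilinearPred.nat_le (hf.add (.const 1)) hg

end Semilinear

section Convexity

variable {N : Type*} [AddCommMonoid N]

/-- `s` contains every point between two of its points on a progression of step `u`. -/
def ConvexAlong (u : N) (s : Set N) : Prop :=
  ∀ z ∈ s, ∀ k : ℕ, z + k • u ∈ s → ∀ j ≤ k, z + j • u ∈ s

namespace ConvexAlong

variable {u : N} {s t : Set N}

theorem univ : ConvexAlong u Set.univ :=
  fun _ _ _ _ _ _ => Set.mem_univ _

theorem inter (hs : ConvexAlong u s) (ht : ConvexAlong u t) : ConvexAlong u (s ∩ t) :=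
  fun z hz k hk j hj => ⟨hs z hz.1 k hk.1 j hj, ht z hz.2 k hk.2 j hj⟩

theorem nsmul (hs : ConvexAlong u s) (m : ℕ) : ConvexAlong (m • u) s := fun z hz k hk j hj => by
  rw [← mul_nsmul'] at hk ⊢
  exact hs z hz _ hk _ (Nat.mul_le_mul_right m hj)

open scoped Pointwise in
theorem vadd [IsLeftCancelAdd N] (hs : ConvexAlong u s) (b : N) : ConvexAlong u (b +ᵥ s) := by
  rintro _ ⟨z, hz, rfl⟩ k ⟨z', hz', hzz'⟩ j hj
  have hk : z + k • u ∈ s := by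
    rwa [← add_left_cancel (a := b) (hzz'.trans (add_assoc b z _))]
  exact ⟨z + j • u, hs z hz k hk j hj, (add_assoc b z _).symm⟩

theorem ordConnected (hs : ConvexAlong u s) (z : N) : {k : ℕ | z + k • u ∈ s}.OrdConnected := by
  refine ⟨fun i hi k hk j hj => ?_⟩
  have hshift : ∀ m, i ≤ m → z + m • u = z + i • u + (m - i) • u := fun m hm => by
    rw [add_assoc, ← add_nsmul, Nat.add_sub_cancel' hm]
  simp only [Set.mem_ofPred_eq] at hi hk ⊢
  rw [hshift j hj.1]
  rw [hshift k (hj.1.trans hj.2)] at hk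
  exact hs _ hi _ hk _ (Nat.sub_le_sub_right hj.2 i)

end ConvexAlong

theorem mul_le_add_mul_of_add_mul_eq {c d e f j k : ℕ} (h : f + k * c = e + k * d) (hjk : j ≤ k) :
    j * c ≤ e + j * d := by
  obtain ⟨m, rfl⟩ := Nat.exists_eq_add_of_le hjk
  rcases le_total c d with hcd | hdc <;> nlinarith

/- If `S d = S c + D • u`, then `S f = S e + k • D • u` forces `f = e + k (d - c)`, so that
`e + j (d - c)` lies between `e` and `f` and is nonnegative. -/
theorem exists_convexAlong_range {ι : Type*} [IsCancelAdd N] (S : (ι →₀ ℕ) →+ N)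
    (hS : Function.Injective S) (u : N) : ∃ D > 0, ConvexAlong (D • u) (Set.range S) := by
  by_cases hex : ∃ D > 0, ∃ c d, S d = S c + D • u
  · obtain ⟨D, hD, c, d, hcd⟩ := hex
    refine ⟨D, hD, ?_⟩
    rintro _ ⟨e, rfl⟩ k ⟨f, hf⟩ j hjk
    have hef : f + k • c = e + k • d := hS <| by
      rw [map_add, map_add, map_nsmul, map_nsmul, hf, hcd, nsmul_add]
      abel
    have hle : j • c ≤ e + j • d := fun i =>
      mul_le_add_mul_of_add_mul_eq (DFunLike.congr_fun hef i) hjk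
    refine ⟨e + j • d - j • c, add_right_cancel (b := S (j • c)) ?_⟩
    rw [← map_add, tsub_add_cancel_of_le hle, map_add, map_nsmul, map_nsmul, hcd, nsmul_add]
    abel
  · refine ⟨1, one_pos, ?_⟩
    rintro _ ⟨e, rfl⟩ k ⟨f, hf⟩ j hjk
    have hk : k = 0 := by
      by_contra hk
      exact hex ⟨k, Nat.pos_of_ne_zero hk, e, f, by simpa using hf⟩
    exact ⟨e, by simp [Nat.le_zero.mp (hk ▸ hjk)]⟩

theorem exists_convexAlong_of_isProperLinearSet [IsCancelAdd N] {s : Set N}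
    (hs : IsProperLinearSet s) (u : N) : ∃ D > 0, ConvexAlong (D • u) s := by
  obtain ⟨b, t, -, ht, rfl⟩ := hs
  have hrange : Set.range (Finsupp.linearCombination ℕ fun x : t => (x : N)) =
      AddSubmonoid.closure t := by
    rw [← LinearMap.coe_range, Finsupp.range_linearCombination, Subtype.range_coe,
      ← Submodule.span_nat_eq_addSubmonoidClosure, Submodule.coe_toAddSubmonoid]
  obtain ⟨D, hD, hconv⟩ := exists_convexAlong_range
    (Finsupp.linearCombination ℕ fun x : t => (x : N)).toAddMonoidHom ht u
  rw [LinearMap.toAddMonoidHom_coe, hrange] at hconv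
  exact ⟨D, hD, hconv.vadd b⟩

theorem exists_forall_convexAlong [IsCancelAdd N] (S : Finset (Set N))
    (hS : ∀ s ∈ S, IsProperLinearSet s) (u : N) : ∃ D > 0, ∀ s ∈ S, ConvexAlong (D • u) s := by
  choose! D hD hconv using fun s hs => exists_convexAlong_of_isProperLinearSet (hS s hs) u
  refine ⟨∏ s ∈ S, D s, Finset.prod_pos hD, fun s hs => ?_⟩
  obtain ⟨m, hm⟩ := Finset.dvd_prod_of_mem D hs
  rw [hm, mul_nsmul]
  exact (hconv s hs).nsmul m

end Convexity

section Counting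

theorem exists_eq_Ico_card_of_ordConnected {s : Finset ℕ} (hs : (s : Set ℕ).OrdConnected) :
    ∃ a, s = Finset.Ico a (a + s.card) := by
  rcases s.eq_empty_or_nonempty with rfl | hne
  · exact ⟨0, by simp⟩
  have hIcc : s = Finset.Icc (s.min' hne) (s.max' hne) := by
    ext y
    rw [Finset.mem_Icc]
    exact ⟨fun hy => ⟨s.min'_le y hy, s.le_max' y hy⟩,
      fun hy => hs.out (s.min'_mem hne) (s.max'_mem hne) hy⟩
  have hle : s.min' hne ≤ s.max' hne := s.min'_le_max' hne
  refine ⟨s.min' hne, ?_⟩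
  have hcard : s.min' hne + s.card = s.max' hne + 1 := by
    rw [congrArg Finset.card hIcc, Nat.card_Icc]
    omega
  rw [hcard, Finset.Ico_add_one_right_eq_Icc]
  exact hIcc

theorem ncard_eq_iff_exists_eq_Ico {s : Set ℕ} (hs : s.OrdConnected) (hfin : s.Finite) {n : ℕ} :
    s.ncard = n ↔ ∃ a, s = Set.Ico a (a + n) := by
  constructor
  · rintro rfl
    lift s to Finset ℕ using hfin
    obtain ⟨a, ha⟩ := exists_eq_Ico_card_of_ordConnected hs
    exact ⟨a, by rw [Set.ncard_coe_finset, ← Finset.coe_Ico, ← ha]⟩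
  · rintro ⟨a, rfl⟩
    rw [← Finset.coe_Ico, Set.ncard_coe_finset, Nat.card_Ico, Nat.add_sub_cancel_left]

theorem injective_add_mul {D : ℕ} (hD : 0 < D) (r : ℕ) : Function.Injective fun k => r + D * k :=
  (add_right_injective r).comp (mul_right_injective₀ hD.ne')

theorem ncard_eq_sum_residues {D : ℕ} (hD : 0 < D) {s : Set ℕ} (hs : s.Finite) :
    s.ncard = ∑ r ∈ Finset.range D, {k | r + D * k ∈ s}.ncard := by
  lift s to Finset ℕ using hs
  have hmod : Set.MapsTo (· % D) s (Finset.range D) := fun y _ =>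
    Finset.mem_coe.mpr (Finset.mem_range.mpr (Nat.mod_lt y hD))
  rw [Set.ncard_coe_finset, Finset.card_eq_sum_card_fiberwise hmod]
  refine Finset.sum_congr rfl fun r hr => ?_
  have hclass : ↑{y ∈ s | y % D = r} = (fun k => r + D * k) '' {k | r + D * k ∈ (s : Set ℕ)} := by
    ext y
    simp only [Finset.coe_filter, Finset.mem_coe, Set.mem_image, Set.mem_ofPred_eq]
    constructor
    · rintro ⟨hy, rfl⟩
      exact ⟨y / D, by rwa [Nat.mod_add_div], Nat.mod_add_div y D⟩
    · rintro ⟨k, hk, rfl⟩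
      exact ⟨hk, by rw [Nat.add_mul_mod_self_left, Nat.mod_eq_of_lt (Finset.mem_range.mp hr)]⟩
  rw [← Set.ncard_coe_finset, hclass, Set.ncard_image_of_injective _ (injective_add_mul hD r)]

variable {M : Type*} [AddCommMonoid M] [AddMonoid.FG M]

theorem semilinearFun_ncard_of_ordConnected {p : M → ℕ → Prop}
    (hp : SemilinearPred fun z : M × ℕ => p z.1 z.2) (hfin : ∀ x, {y | p x y}.Finite)
    (hconn : ∀ x, {y | p x y}.OrdConnected) : SemilinearFun fun x => {y | p x y}.ncard := by
  have hIco : SemilinearPred fun z : M × ℕ => ∃ a, ∀ y, p z.1 y ↔ a ≤ y ∧ y < a + z.2 := by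
    refine .exists <| .forall <| .iff
      (hp.comp (f := fun q : ((M × ℕ) × ℕ) × ℕ => (q.1.1.1, q.2)) ?_)
      (.and (.nat_le ?_ ?_) (.nat_lt ?_ ?_))
    all_goals fun_prop
  refine hIco.congr fun z => ?_
  rw [ncard_eq_iff_exists_eq_Ico (hconn z.1) (hfin z.1)]
  simp only [Set.ext_iff, Set.mem_ofPred_eq, Set.mem_Ico]

theorem semilinearFun_ncard_of_convexAlong {D : ℕ} (hD : 0 < D) {s : Set (M × ℕ)}
    (hs : IsSemilinearSet s) (hconv : ConvexAlong (D • (0, 1)) s)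
    (hfin : ∀ x, {y | (x, y) ∈ s}.Finite) : SemilinearFun fun x => {y | (x, y) ∈ s}.ncard := by
  simp only [fun x => ncard_eq_sum_residues hD (hfin x), Set.mem_ofPred_eq]
  refine .sum _ fun r _ => semilinearFun_ncard_of_ordConnected ?_ (fun x => ?_) fun x => ?_
  · exact SemilinearPred.comp (p := (· ∈ s)) (f := fun z : M × ℕ => (z.1, r + D * z.2)) hs
      (by fun_prop)
  · exact show ((r + D * ·) ⁻¹' {y | (x, y) ∈ s}).Finite from
      (hfin x).preimage (injective_add_mul hD r).injOn
  · simpa [mul_comm] using hconv.ordConnected (x, r)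

theorem SemilinearFun.ncard_union {s t : Set (M × ℕ)} (hs : ∀ x, {y | (x, y) ∈ s}.Finite)
    (ht : ∀ x, {y | (x, y) ∈ t}.Finite) (hcs : SemilinearFun fun x => {y | (x, y) ∈ s}.ncard)
    (hct : SemilinearFun fun x => {y | (x, y) ∈ t}.ncard)
    (hcst : SemilinearFun fun x => {y | (x, y) ∈ s ∩ t}.ncard) :
    SemilinearFun fun x => {y | (x, y) ∈ s ∪ t}.ncard :=
  .of_add_eq hcst (hcs.add hct) fun x => Set.ncard_union_add_ncard_inter _ _ (hs x) (ht x)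

/- Induction along inclusion–exclusion: the spare factor `r` absorbs the intersection terms. -/
theorem semilinearFun_ncard_inter_sUnion {D : ℕ} (hD : 0 < D) (S : Finset (Set (M × ℕ)))
    (hS : ∀ s ∈ S, IsSemilinearSet s) (hconv : ∀ s ∈ S, ConvexAlong (D • (0, 1)) s)
    (hfin : ∀ x, {y | (x, y) ∈ ⋃₀ (S : Set (Set (M × ℕ)))}.Finite) {r : Set (M × ℕ)}
    (hr : IsSemilinearSet r) (hrconv : ConvexAlong (D • (0, 1)) r) :
    SemilinearFun fun x => {y | (x, y) ∈ r ∩ ⋃₀ S}.ncard := by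
  induction S using Finset.cons_induction generalizing r with
  | empty => simpa using SemilinearFun.const 0
  | cons s S hsS ih =>
    simp only [Finset.mem_cons, forall_eq_or_imp] at hS hconv
    simp only [Finset.coe_cons, Set.sUnion_insert] at hfin ⊢
    rw [Set.inter_union_distrib_left]
    have hrs := hrconv.inter hconv.1
    have hfin_rs : ∀ x, {y | (x, y) ∈ r ∩ s}.Finite := fun x =>
      (hfin x).subset fun _ hy => .inl hy.2
    have hfin_S : ∀ x, {y | (x, y) ∈ ⋃₀ (S : Set (Set (M × ℕ)))}.Finite := fun x =>
      (hfin x).subset fun _ hy => .inr hy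
    refine .ncard_union hfin_rs (fun x => (hfin_S x).subset fun _ hy => hy.2)
      (semilinearFun_ncard_of_convexAlong hD (hr.inter hS.1) hrs hfin_rs)
      (ih hS.2 hconv.2 hfin_S hr hrconv) ?_
    rw [← Set.inter_inter_distrib_left, ← Set.inter_assoc]
    exact ih hS.2 hconv.2 hfin_S (hr.inter hS.1) hrs

theorem SemilinearFun.ncard [IsCancelAdd M] {p : M → ℕ → Prop}
    (hp : SemilinearPred fun z : M × ℕ => p z.1 z.2) (hfin : ∀ x, {y | p x y}.Finite) :
    SemilinearFun fun x => {y | p x y}.ncard := by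
  obtain ⟨S, hS, hpS⟩ := isProperSemilinearSet_iff.mp (IsSemilinearSet.isProperSemilinearSet hp)
  obtain ⟨D, hD, hconv⟩ := exists_forall_convexAlong S hS (0, 1)
  have hcount := semilinearFun_ncard_inter_sUnion hD S
    (fun s hs => (hS s hs).isLinearSet.isSemilinearSet) hconv (by simpa [← hpS] using hfin)
    .univ .univ
  simpa [← hpS] using hcount

end Counting

section Words

universe u

variable {α : Type u} {M : Type*} [AddCommMonoid M]

/-- A family of words, indexed by a commutative monoid, whose lengths and letters are described by
a semilinear function and semilinear predicates. These are the words over which the semantics of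
`LTL[Count]` stays semilinear. -/
structure SemilinearWord (w : M → List α) : Prop where
  length : SemilinearFun fun x => (w x).length
  getElem? (a : α) : SemilinearPred fun z : M × ℕ => (w z.1)[z.2]? = some a

namespace SemilinearWord

variable [AddMonoid.FG M]

theorem nil : SemilinearWord fun _ : M => ([] : List α) where
  length := .const 0
  getElem? _ := by simpa using SemilinearPred.const False

theorem replicate {f : M → ℕ} (hf : SemilinearFun f) (a : α) :
    SemilinearWord fun x => List.replicate (f x) a where
  length := by simpa using hf
  getElem? b := by
    simpa [List.getElem?_replicate] using
      (SemilinearPred.nat_lt (.snd (M := M)) (by fun_prop)).and (.const (a = b))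

theorem append {v w : M → List α} (hv : SemilinearWord v) (hw : SemilinearWord w) :
    SemilinearWord fun x => v x ++ w x where
  length := by simpa using hv.length.add hw.length
  getElem? a := by
    have hshift : SemilinearPred fun z : M × ℕ =>
        ∃ j, z.2 = (v z.1).length + j ∧ (w z.1)[j]? = some a := by
      exact .exists <| .and
        (.eq (by fun_prop) (.add (hv.length.comp (by fun_prop)) (by fun_prop)))
        ((hw.getElem? a).comp (f := fun q : (M × ℕ) × ℕ => (q.1.1, q.2)) (by fun_prop))
    refine ((hv.getElem? a).or hshift).congr fun z => ?_
    rw [List.getElem?_append]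
    split_ifs with hz
    · exact ⟨.inl, fun h => h.resolve_right fun ⟨_, _, _⟩ => by omega⟩
    · rw [not_lt] at hz
      simp only [List.getElem?_eq_none hz, reduceCtorEq, false_or]
      refine ⟨fun h => ⟨_, (Nat.add_sub_cancel' hz).symm, h⟩, ?_⟩
      rintro ⟨j, hj, h⟩
      rwa [hj, Nat.add_sub_cancel_left]

theorem flatMap {ι : Type*} (l : List ι) {w : ι → M → List α} (hw : ∀ i, SemilinearWord (w i)) :
    SemilinearWord fun x => l.flatMap fun i => w i x := by
  induction l with
  | nil => exact nil
  | cons i l ih => simpa only [List.flatMap_cons] using (hw i).append ih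

variable {w : M → List α}

mutual

theorem semilinearPred_sat [IsCancelAdd M] (hw : SemilinearWord w) : ∀ φ : Formula α,
    SemilinearPred fun z : M × ℕ => Sat (w z.1) φ z.2
  | .letter a => by simpa only [Sat] using hw.getElem? a
  | .le s t => by
    simpa only [Sat] using .int_le (hw.semilinearFun_termVal s) (hw.semilinearFun_termVal t)
  | .neg φ => by simpa only [Sat] using (hw.semilinearPred_sat φ).not
  | .or φ ψ => by
    simpa only [Sat] using (hw.semilinearPred_sat φ).or (hw.semilinearPred_sat ψ)
  | .next φ => by
    have hφ := (hw.semilinearPred_sat φ).comp (f := fun z : M × ℕ => (z.1, z.2 + 1)) (by fun_prop)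
    simpa only [Sat] using .and (.nat_lt (by fun_prop) (hw.length.comp (by fun_prop))) hφ
  | .untl φ ψ => by
    have hφ := (hw.semilinearPred_sat φ).comp
      (f := fun q : ((M × ℕ) × ℕ) × ℕ => (q.1.1.1, q.2)) (by fun_prop)
    have hψ := (hw.semilinearPred_sat ψ).comp
      (f := fun q : (M × ℕ) × ℕ => (q.1.1, q.2)) (by fun_prop)
    simp only [Sat]
    refine .exists <| .and (.nat_le ?_ ?_) <| .and (.nat_lt ?_ (hw.length.comp ?_)) <| .and hψ <|
      .forall <| .imp (.nat_le ?_ ?_) <| .imp (.nat_lt ?_ ?_) hφ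
    all_goals fun_prop

theorem semilinearFun_termVal [IsCancelAdd M] (hw : SemilinearWord w) : ∀ t : Term α,
    SemilinearFun fun z : M × ℕ => termVal (w z.1) t z.2
  | .const k => by simpa only [termVal] using .const k
  | .countLeft k φ => by
    have hφ := (hw.semilinearPred_sat φ).comp
      (f := fun q : (M × ℕ) × ℕ => (q.1.1, q.2)) (by fun_prop)
    simp only [termVal]
    refine .const_mul k (.natCast (.ncard (.and (.nat_lt ?_ ?_) hφ) fun z => ?_))
    · fun_prop
    · fun_prop
    · exact (Set.finite_lt_nat z.2).subset fun _ hj => hj.1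
  | .countRight k φ => by
    have hφ := (hw.semilinearPred_sat φ).comp
      (f := fun q : (M × ℕ) × ℕ => (q.1.1, q.2)) (by fun_prop)
    simp only [termVal]
    refine .const_mul k (.natCast (.ncard
      (.and (.nat_le ?_ ?_) (.and (.nat_lt ?_ (hw.length.comp ?_)) hφ))
      fun z => (Set.finite_lt_nat (w z.1).length).subset fun _ hj => hj.2.1))
    all_goals fun_prop
  | .add s t => by
    simpa only [termVal] using (hw.semilinearFun_termVal s).add (hw.semilinearFun_termVal t)

end

end SemilinearWord

theorem Definable.semilinearPred_mem [AddMonoid.FG M] [IsCancelAdd M] {L : Language α}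
    (hL : Definable L) {w : M → List α} (hw : SemilinearWord w) :
    SemilinearPred fun x => w x ∈ L := by
  obtain ⟨φ, hφ⟩ := hL
  have hempty : SemilinearPred fun x => (w x).length = 0 := .eq hw.length (.const 0)
  have hsat := (hw.semilinearPred_sat φ).comp (f := fun x : M => (x, 0)) (by fun_prop)
  refine ((hempty.and (.const ([] ∈ L))).or (hempty.not.and hsat)).congr fun x => ?_
  rw [List.length_eq_zero_iff]
  by_cases hx : w x = []
  · simp [hx]
  · simp [hx, hφ]

variable [Fintype α]

/-- The word with Parikh vector `n` in which equal letters are adjacent. The order of the letters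
is an arbitrary choice. -/
noncomputable def blockWord (n : α → ℕ) : List α :=
  Finset.univ.toList.flatMap fun a => List.replicate (n a) a

theorem parikh_blockWord [DecidableEq α] (n : α → ℕ) : parikh (blockWord n) = n := by
  funext a
  simp [parikh, blockWord, List.count_flatMap, Function.comp_def, List.count_replicate,
    Finset.sum_map_toList]

theorem semilinearWord_blockWord : SemilinearWord (blockWord (α := α)) :=
  .flatMap _ fun a => .replicate (.of_hom (Pi.evalAddMonoidHom (fun _ : α => ℕ) a)) a

theorem PermutationInvariant.mem_parikhImage_iff [DecidableEq α] {L : Language α}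
    (hL : PermutationInvariant L) {n : α → ℕ} : n ∈ parikhImage L ↔ blockWord n ∈ L := by
  constructor
  · rintro ⟨w, hw, rfl⟩
    exact (hL _ _ (parikh_blockWord _)).mpr hw
  · exact fun h => ⟨_, h, parikh_blockWord n⟩

end Words

end LTLCount

theorem mainTheorem9 {α : Type*} [Finite α] [DecidableEq α] (L : Language α)
    (hdef : LTLCount.Definable L) (hperm : LTLCount.PermutationInvariant L) :
    IsSemilinearSet (LTLCount.parikhImage L) := by
  have := Fintype.ofFinite α
  exact (hdef.semilinearPred_mem LTLCount.semilinearWord_blockWord).congr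
    fun _ => hperm.mem_parikhImage_iff
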